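/- **Setting (bandits against an $m$-memory-bounded adaptive adversary).** There are $\ell\ge 1$ arms and $T\ge 0$ rounds. Before the game, the adversary fixes loss functions $L_t:[\ell]^t\to[0,1]$, $t\ge 1$. It is $m$-memory-bounded if $L_t(a_1,\dots,a_t)$ depends only on $t$ and on the last $m+1$ actions $a_{\max(1,t-m)},\dots,a_t$. In round $t$ the learner plays $a_t\in[\ell]$ and observes only its own loss $L_t(a_1,\dots,a_t)$. Its policy regret is $$R_T=\mathbb E\Big[\sum_{t=1}^T L_t(a_1,\dots,a_t)\Big]-\min_{y\in[\ell]}\sum_{t=1}^T L_t(y,\dots,y).$$ **Algorithm.** The parameters are $\varepsilon\in[0,1]$ and $\eta\ge 0$; put $d=m+1$. The learner keeps the weights $w\in(0,\infty)^\ell$ of HEDGE, initially all equal to $1$, the distribution $x_t=w/\sum_j w(j)$, and an exploited arm $i_t$, where $i_1$ is uniform. Round $1$ is an exploitation round. * In an exploitation round $t$ it plays $i_t$ and draws $\beta_t\sim\mathrm{Bernoulli}(\varepsilon)$. If $\beta_t=0$, round $t+1$ is an exploitation round. * If $\beta_t=1$, it draws an arm $e$ uniformly at random and plays $e$ in the $d$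 rounds $t+1,\dots,t+d$ (as far as they are at most $T$). The observed loss $c$ of round $t+d$ is the feedback: $w(e)$ is replaced by $w(e)\exp(-\eta c)$, and the other weights are unchanged. Round $t+d+1$ is an exploitation round. * Weights and exploited arm change only after such feedback. If then $x_{t}\ne x_{t-1}$, the new exploited arm is chosen by the procedure Round: $i_t=j$ with probability $\tau_{i,j}/x_{t-1}(i)$, where $i=i_{t-1}$ and $\tau\ge 0$ is any transport plan from $x_{t-1}$ to $x_t$ (row sums $x_{t-1}$, column sums $x_t$) that moves the least possible mass, $\sum_{i\ne j}\tau_{i,j}=\sum_i\max(0,x_{t-1}(i)-x_t(i))$. If $x_t=x_{t-1}$, then $i_t=i_{t-1}$. All random choices are independent given the past. **Theorem.** There is a universal constant $C>0$ such that the following holds for all $\ell\ge 1$, $m\ge 1$ and $T\ge 0$. If $m\ell\ln\ell<T$, let $$\varepsilon=(\ell\ln\ell)^{1/3}m^{-2/3}T^{-1/3},\qquad 1-e^{-\eta}=(m\ell\ln\ell)^{1/3}T^{-1/3};$$ if $m\ell\ln\ell\ge T$, let $\varepsilon\in[0,1]$ and $\eta\ge 0$ be arbitrary. Then, for every choice of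 the transport plans and against every $m$-memory-bounded adaptive adversary, the algorithm has policy regret $$R_T\le C\,(m\,\ell\ln\ell)^{1/3}\,T^{2/3}.$$ -/

import Mathlib

noncomputable section

namespace MemoryBandit

/-! ### Bandits against adaptive adversaries -/

/-- An action history, most recent action first.  The history of the first `t` rounds is a list of
length `t`. -/
abbrev History (ℓ : ℕ) := List (Fin ℓ)

/-- An adaptive adversary: before the game it fixes, for every `t`, a function that assigns a loss
in `[0, 1]` to every sequence `a₁, …, a_t` of actions of the first `t` rounds.  The loss suffered
in round `t` is `loss [a_t, …, a₁]` (the round is the length of the history). -/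
structure Adversary (ℓ : ℕ) where
  loss : History ℓ → ℝ
  loss_mem : ∀ h, loss h ∈ Set.Icc (0 : ℝ) 1

/-- `m`-memory-bounded: in every round the loss depends only on the round and on the current action
and the `m` actions before it, that is, on the last `m + 1` actions. -/
def Adversary.MemoryBounded {ℓ : ℕ} (A : Adversary ℓ) (m : ℕ) : Prop :=
  ∀ h h' : History ℓ, h.length = h'.length → h.take (m + 1) = h'.take (m + 1) →
    A.loss h = A.loss h'

/-- The total loss `∑_{s ≤ t} loss (a₁, …, a_s)` along a history of `t` rounds. -/
def Adversary.totalLoss {ℓ : ℕ} (A : Adversary ℓ) : History ℓ → ℝ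
  | [] => 0
  | a :: h => A.loss (a :: h) + A.totalLoss h

/-- The expectation of a real random variable under a discrete law. -/
def expect {α : Type*} (p : PMF α) (φ : α → ℝ) : ℝ := ∑' a, (p a).toReal * φ a

/-- The policy regret of a random history `p` of `T` rounds: the expected total loss minus the
total loss `∑_{t ≤ T} loss (y, …, y)` of the best constant action sequence `y, …, y`. -/
def policyRegret {ℓ : ℕ} [NeZero ℓ] (A : Adversary ℓ) (T : ℕ) (p : PMF (History ℓ)) : ℝ :=
  expect p A.totalLoss -
    Finset.univ.inf' Finset.univ_nonempty fun y : Fin ℓ => A.totalLoss (List.replicate T y)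

/-! ### HEDGE -/

/-- The distribution played by HEDGE with weights `w`. -/
def hedgeDist {ℓ : ℕ} (w : Fin ℓ → ℝ) (i : Fin ℓ) : ℝ := w i / ∑ j, w j

/-- The HEDGE update with learning rate `η` after the loss vector `g`. -/
def hedgeUpdate {ℓ : ℕ} (η : ℝ) (w g : Fin ℓ → ℝ) (i : Fin ℓ) : ℝ := w i * Real.exp (-η * g i)

/-! ### The procedure Round -/

/-- `τ i j` is the mass moved from `i` to `j` by an optimal transport plan from the distribution
`p` to the distribution `q`, where moving a unit of mass between different points costs `1`. -/
def IsOptimalTransport {ℓ : ℕ} (p q : Fin ℓ → ℝ) (τ : Fin ℓ → Fin ℓ → ℝ) : Prop :=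
  (∀ i j, 0 ≤ τ i j) ∧ (∀ i, ∑ j, τ i j = p i) ∧ (∀ j, ∑ i, τ i j = q j) ∧
    ∑ i, ∑ j ∈ Finset.univ.erase i, τ i j = ∑ i, max 0 (p i - q i)

/-- A choice of an optimal transport plan between any two distributions on the arms. -/
def IsTransportRule {ℓ : ℕ} (τ : (Fin ℓ → ℝ) → (Fin ℓ → ℝ) → Fin ℓ → Fin ℓ → ℝ) : Prop :=
  ∀ p ∈ stdSimplex ℝ (Fin ℓ), ∀ q ∈ stdSimplex ℝ (Fin ℓ), IsOptimalTransport p q (τ p q)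

open Classical in
/-- `Round`: from `i`, move to `j` with probability `τ i j / p i`, where `τ` is a plan that
transports `p`.  (The second branch is never reached when `τ` is such a plan and `p i > 0`.) -/
def round {ℓ : ℕ} (p : Fin ℓ → ℝ) (τ : Fin ℓ → Fin ℓ → ℝ) (i : Fin ℓ) : PMF (Fin ℓ) :=
  if h : 0 < p i ∧ (∀ j, 0 ≤ τ i j) ∧ ∑ j, τ i j = p i then
    PMF.ofFintype (fun j => ENNReal.ofReal (τ i j / p i)) (by
      obtain ⟨hp, hτ, hs⟩ := h
      rw [← ENNReal.ofReal_sum_of_nonneg fun j _ => div_nonneg (hτ j) hp.le,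
        ← Finset.sum_div, hs, div_self hp.ne', ENNReal.ofReal_one])
  else PMF.pure i

/-! ### The algorithm -/

/-- A coin that shows `true` with probability `ε`. -/
def coin (ε : unitInterval) : PMF Bool :=
  PMF.ofFintype (fun b => ENNReal.ofReal (if b then (ε : ℝ) else 1 - ε)) (by
    rw [Fintype.sum_bool, ← ENNReal.ofReal_add (by simpa using ε.2.1) (by simpa using ε.2.2)]
    simp)

/-- The state of the algorithm between two rounds:
* `w`, the current weights of HEDGE, so that `x = hedgeDist w` is the current distribution;
* `i`, the exploited arm, rounded from `x`;
* `block = none` if the next round is an exploitation round, and `block = some (e, k)` if the next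
  `k` rounds form (the rest of) the bootstrapping of arm `e`, the last of these `k` rounds being
  the exploration round in which the loss of `e` is used as feedback;
* `hist`, the actions played so far. -/
structure State (ℓ : ℕ) where
  w : Fin ℓ → ℝ
  i : Fin ℓ
  block : Option (Fin ℓ × ℕ)
  hist : History ℓ

/-- The state before the first round: all weights are `1`, and the exploited arm is uniform. -/
def init (ℓ : ℕ) [NeZero ℓ] : PMF (State ℓ) :=
  (PMF.uniformOfFintype (Fin ℓ)).map fun i => ⟨fun _ => 1, i, none, []⟩

open Classical in
/-- One round with exploration probability `ε`, learning rate `η` and delay `d`.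

In an exploitation round `t` the exploited arm `i_t` is played and `β_t ∼ Bernoulli(ε)` is drawn.
If `β_t = 1`, a uniform arm `e` is drawn and the next `d` rounds `t + 1, …, t + d` are used to
explore it; otherwise round `t + 1` is again an exploitation round.

In the rounds `t + 1, …, t + d` the arm `e` is played.  The observed loss of round `t + d` is fed to
HEDGE as the loss of `e`, the other arms getting loss `0`.  If the distribution has changed,
`Round` chooses the new exploited arm.  Round `t + d + 1` is an exploitation round.

The adversary is accessed only through the loss of the action that is actually played. -/
def step {ℓ : ℕ} [NeZero ℓ] (A : Adversary ℓ) (ε : unitInterval) (η : ℝ) (d : ℕ)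
    (τ : (Fin ℓ → ℝ) → (Fin ℓ → ℝ) → Fin ℓ → Fin ℓ → ℝ) (s : State ℓ) : PMF (State ℓ) :=
  match s.block with
  | none =>
    (coin ε).bind fun β =>
      if β then
        (PMF.uniformOfFintype (Fin ℓ)).map fun e => ⟨s.w, s.i, some (e, d), s.i :: s.hist⟩
      else PMF.pure ⟨s.w, s.i, none, s.i :: s.hist⟩
  | some (e, k) =>
    if 1 < k then PMF.pure ⟨s.w, s.i, some (e, k - 1), e :: s.hist⟩
    else
      let g : Fin ℓ → ℝ := fun j => if j = e then A.loss (e :: s.hist) else 0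
      let w' := hedgeUpdate η s.w g
      let x := hedgeDist s.w
      let x' := hedgeDist w'
      (if x' ≠ x then round x (τ x x') s.i else PMF.pure s.i).map
        fun i' => ⟨w', i', none, e :: s.hist⟩

/-- The law of the state after `t` rounds. -/
def run {ℓ : ℕ} [NeZero ℓ] (A : Adversary ℓ) (ε : unitInterval) (η : ℝ) (d : ℕ)
    (τ : (Fin ℓ → ℝ) → (Fin ℓ → ℝ) → Fin ℓ → Fin ℓ → ℝ) : ℕ → PMF (State ℓ)
  | 0 => init ℓ
  | t + 1 => (run A ε η d τ t).bind (step A ε η d τ)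

/-- The law of the actions played in the first `T` rounds. -/
def play {ℓ : ℕ} [NeZero ℓ] (A : Adversary ℓ) (ε : unitInterval) (η : ℝ) (d : ℕ)
    (τ : (Fin ℓ → ℝ) → (Fin ℓ → ℝ) → Fin ℓ → Fin ℓ → ℝ) (T : ℕ) : PMF (History ℓ) :=
  (run A ε η d τ T).map State.hist

end MemoryBandit

end

/-! An explored arm is played m + 1 times in a row, so its observed loss is a value of the oblivious
losses `A.constLoss`, whatever was played before. The evolution of the weights therefore does not
involve the exploited arm, and since `Round` carries the law x to the law x', the exploited arm has
the HEDGE distribution given weights and block (`expect_run_eq_hedgeMean`).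

The regret is controlled by a potential with three parts, one round at a time
(`State.Valid.expect_step_potential_le`). (1) The contamination pays for the gap between the actual
loss and `A.constLoss`. It falls with every exploitation round and is at most m after an
exploration. The exploited arm changes only then, so switching costs nothing extra. (2) B = ℓ / ε
times the HEDGE divergence over δ = 1 - exp (-η). An exploitation round triggers feedback about a
uniform arm with probability ε, so the mean drop is the HEDGE regret m + 1 rounds later, up to 2δ.
The adversary is fixed in advance, so this drop can be booked already when the exploration is
decided. (3) The window regret moves that regret from round t + 1 + (m + 1) back to round t + 1. It
telescopes while the weights stay fixed and is given up, at cost m + 1, at an exploration.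

Altogether the regret is at most 2(m + 1) + ℓ log ℓ / (εδ) + T(2δ + ε(4m + 6))
(`expect_totalLoss_le`). The parameters satisfy mε = δ and δ³T = mℓ log ℓ, which makes every term
O(δT). -/

namespace MemoryBandit

/-! ### Expectations under finitely supported laws -/

section Expectation

variable {α β : Type*}

lemma expect_eq_sum {p : PMF α} {S : Finset α} (hS : p.support ⊆ S) (φ : α → ℝ) :
    expect p φ = ∑ a ∈ S, (p a).toReal * φ a := by
  refine tsum_eq_sum fun a ha => ?_
  have : p a = 0 := by
    rw [PMF.apply_eq_zero_iff]
    exact fun h => ha (hS h)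
  simp [this]

lemma expect_eq_sum_univ [Fintype α] (p : PMF α) (φ : α → ℝ) :
    expect p φ = ∑ a, (p a).toReal * φ a :=
  expect_eq_sum (by simp) φ

lemma sum_toReal_eq_one {p : PMF α} {S : Finset α} (hS : p.support ⊆ S) :
    ∑ a ∈ S, (p a).toReal = 1 := by
  have h : ∑ a ∈ S, p a = 1 := by
    rw [← p.tsum_coe, tsum_eq_sum fun a ha => ?_]
    rw [PMF.apply_eq_zero_iff]
    exact fun h => ha (hS h)
  rw [← ENNReal.toReal_sum fun a _ => p.apply_ne_top a, h, ENNReal.toReal_one]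

lemma expect_pure (a : α) (φ : α → ℝ) : expect (PMF.pure a) φ = φ a := by
  rw [expect_eq_sum (S := {a}) (by simp)]
  simp

lemma finite_support_bind {p : PMF α} {f : α → PMF β} (hp : p.support.Finite)
    (hf : ∀ a, (f a).support.Finite) : (p.bind f).support.Finite := by
  rw [PMF.support_bind]
  exact hp.biUnion fun a _ => hf a

lemma finite_support_map {p : PMF α} (hp : p.support.Finite) (f : α → β) :
    (p.map f).support.Finite := by
  rw [PMF.support_map]
  exact hp.image f

/-- Finite supports turn all series into finite sums, so no summability or boundedness of `φ` is
needed, although the states form an infinite type. -/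
lemma expect_bind {p : PMF α} {f : α → PMF β} (hp : p.support.Finite)
    (hf : ∀ a, (f a).support.Finite) (φ : β → ℝ) :
    expect (p.bind f) φ = expect p fun a => expect (f a) φ := by
  have hb := finite_support_bind hp hf
  rw [expect_eq_sum (S := hb.toFinset) (by simp), expect_eq_sum (S := hp.toFinset) (by simp)]
  have h1 : ∀ b, ((p.bind f) b).toReal =
      ∑ a ∈ hp.toFinset, (p a).toReal * (f a b).toReal := by
    intro b
    rw [PMF.bind_apply, tsum_eq_sum (s := hp.toFinset), ENNReal.toReal_sum]
    · simp
    · exact fun a _ => ENNReal.mul_ne_top (p.apply_ne_top a) ((f a).apply_ne_top b)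
    · intro a ha
      have : p a = 0 := by
        rw [PMF.apply_eq_zero_iff]
        simpa using ha
      simp [this]
  have h2 : ∀ a ∈ hp.toFinset, (p a).toReal * expect (f a) φ =
      ∑ b ∈ hb.toFinset, (p a).toReal * (f a b).toReal * φ b := by
    intro a ha
    rw [expect_eq_sum (S := hb.toFinset), Finset.mul_sum]
    · simp only [mul_assoc]
    · intro b hb'
      rw [Set.Finite.coe_toFinset, PMF.support_bind]
      exact Set.mem_biUnion (by simpa using ha) hb'
  rw [Finset.sum_congr rfl h2, Finset.sum_comm]
  exact Finset.sum_congr rfl fun b _ => by rw [h1, Finset.sum_mul]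

lemma expect_map {p : PMF α} (hp : p.support.Finite) (f : α → β) (φ : β → ℝ) :
    expect (p.map f) φ = expect p fun a => φ (f a) := by
  rw [← PMF.bind_pure_comp, expect_bind hp fun a => by simp]
  simp [expect_pure]

lemma expect_mono {p : PMF α} (hp : p.support.Finite) {φ ψ : α → ℝ}
    (h : ∀ a ∈ p.support, φ a ≤ ψ a) : expect p φ ≤ expect p ψ := by
  rw [expect_eq_sum (S := hp.toFinset) (by simp), expect_eq_sum (S := hp.toFinset) (by simp)]
  exact Finset.sum_le_sum fun a ha =>
    mul_le_mul_of_nonneg_left (h a (by simpa using ha)) ENNReal.toReal_nonneg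

lemma expect_congr {p : PMF α} {φ ψ : α → ℝ}
    (h : ∀ a ∈ p.support, φ a = ψ a) : expect p φ = expect p ψ := by
  refine tsum_congr fun a => ?_
  by_cases ha : a ∈ p.support
  · rw [h a ha]
  · simp [(p.apply_eq_zero_iff a).2 ha]

lemma expect_add {p : PMF α} (hp : p.support.Finite) (φ ψ : α → ℝ) :
    expect p (fun a => φ a + ψ a) = expect p φ + expect p ψ := by
  have hS : p.support ⊆ hp.toFinset := by simp
  simp only [expect_eq_sum hS, mul_add, Finset.sum_add_distrib]

lemma expect_const {p : PMF α} (hp : p.support.Finite) (c : ℝ) :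
    expect p (fun _ => c) = c := by
  rw [expect_eq_sum (S := hp.toFinset) (by simp), ← Finset.sum_mul,
    sum_toReal_eq_one (by simp), one_mul]

lemma expect_uniformOfFintype [Fintype α] [Nonempty α] (φ : α → ℝ) :
    expect (PMF.uniformOfFintype α) φ = (Fintype.card α : ℝ)⁻¹ * ∑ a, φ a := by
  rw [expect_eq_sum_univ, Finset.mul_sum]
  simp

lemma expect_coin (ε : unitInterval) (φ : Bool → ℝ) :
    expect (coin ε) φ = ε * φ true + (1 - ε) * φ false := by
  rw [expect_eq_sum_univ, Fintype.sum_bool]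
  have := ε.2.1
  have := ε.2.2
  simp [coin, ENNReal.toReal_ofReal, *]

lemma expect_round {ℓ : ℕ} {p : Fin ℓ → ℝ} {τ : Fin ℓ → Fin ℓ → ℝ} {i : Fin ℓ}
    (hp : 0 < p i) (hτ : ∀ j, 0 ≤ τ i j) (hs : ∑ j, τ i j = p i) (φ : Fin ℓ → ℝ) :
    expect (round p τ i) φ = ∑ j, τ i j / p i * φ j := by
  rw [expect_eq_sum_univ]
  refine Finset.sum_congr rfl fun j _ => ?_
  rw [round, dif_pos ⟨hp, hτ, hs⟩, PMF.ofFintype_apply,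
    ENNReal.toReal_ofReal (div_nonneg (hτ j) hp.le)]

end Expectation

/-! ### One step of HEDGE with feedback about a single arm -/

section Hedge

variable {ℓ : ℕ}

lemma hedgeUpdate_pos {w : Fin ℓ → ℝ} (hw : ∀ j, 0 < w j) (η : ℝ) (g : Fin ℓ → ℝ) (j : Fin ℓ) :
    0 < hedgeUpdate η w g j :=
  mul_pos (hw j) (Real.exp_pos _)

lemma sum_weights_pos [NeZero ℓ] {w : Fin ℓ → ℝ} (hw : ∀ j, 0 < w j) : 0 < ∑ j, w j :=
  Finset.sum_pos (fun j _ => hw j) Finset.univ_nonempty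

lemma hedgeDist_pos [NeZero ℓ] {w : Fin ℓ → ℝ} (hw : ∀ j, 0 < w j) (j : Fin ℓ) :
    0 < hedgeDist w j :=
  div_pos (hw j) (sum_weights_pos hw)

lemma sum_hedgeDist [NeZero ℓ] {w : Fin ℓ → ℝ} (hw : ∀ j, 0 < w j) : ∑ j, hedgeDist w j = 1 := by
  simp only [hedgeDist]
  rw [← Finset.sum_div, div_self (sum_weights_pos hw).ne']

lemma hedgeDist_mem [NeZero ℓ] {w : Fin ℓ → ℝ} (hw : ∀ j, 0 < w j) :
    hedgeDist w ∈ stdSimplex ℝ (Fin ℓ) :=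
  ⟨fun j => (hedgeDist_pos hw j).le, sum_hedgeDist hw⟩

/-- The loss vector that is `c` at `e` and vanishes elsewhere. -/
def feedback (e : Fin ℓ) (c : ℝ) (j : Fin ℓ) : ℝ := if j = e then c else 0

/-- The (rescaled) divergence of the HEDGE distribution from the point mass at `y`. -/
noncomputable def hedgePotential (δ : ℝ) (y : Fin ℓ) (w : Fin ℓ → ℝ) : ℝ :=
  (Real.log (∑ j, w j) - Real.log (w y)) / δ

lemma hedgePotential_nonneg {δ : ℝ} (hδ : 0 < δ) (y : Fin ℓ) {w : Fin ℓ → ℝ}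
    (hw : ∀ j, 0 < w j) : 0 ≤ hedgePotential δ y w := by
  refine div_nonneg (sub_nonneg.2 (Real.log_le_log (hw y) ?_)) hδ.le
  exact Finset.single_le_sum (fun j _ => (hw j).le) (Finset.mem_univ y)

/-- Convexity: the chord of the exponential between 0 and -η lies above its graph. -/
lemma exp_neg_mul_le {η c : ℝ} (hc : c ∈ Set.Icc (0 : ℝ) 1) :
    Real.exp (-η * c) ≤ 1 - (1 - Real.exp (-η)) * c := by
  have h := convexOn_exp.2 (Set.mem_univ (0 : ℝ)) (Set.mem_univ (-η))
    (sub_nonneg.2 hc.2) hc.1 (by ring)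
  simp only [smul_eq_mul, mul_zero, zero_add, Real.exp_zero, mul_one] at h
  rw [mul_comm]
  linarith

/-- The chord bound shrinks the total weight by the factor 1 - δ x(e) c at least, and log (1 - z) ≤
-z. The weight of `y` changes only if `y` itself is explored. -/
lemma hedgePotential_update_le [NeZero ℓ] {η δ : ℝ} (hδ : 0 < δ) (hη : 1 - Real.exp (-η) = δ)
    (y e : Fin ℓ) {c : ℝ} (hc : c ∈ Set.Icc (0 : ℝ) 1) {w : Fin ℓ → ℝ} (hw : ∀ j, 0 < w j) :
    hedgePotential δ y (hedgeUpdate η w (feedback e c)) ≤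
      hedgePotential δ y w - hedgeDist w e * c + if e = y then η / δ * c else 0 := by
  have hW := sum_weights_pos hw
  have hW' := sum_weights_pos (hedgeUpdate_pos hw η (feedback e c))
  have hsum : ∑ j, hedgeUpdate η w (feedback e c) j ≤
      (∑ j, w j) * (1 - δ * (hedgeDist w e * c)) := by
    have h1 : ∀ j, hedgeUpdate η w (feedback e c) j ≤
        w j - if j = e then w j * (δ * c) else 0 := by
      intro j
      unfold hedgeUpdate feedback
      split_ifs with h
      · have := mul_le_mul_of_nonneg_left (exp_neg_mul_le (η := η) hc) (hw j).le
        rw [hη] at this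
        linarith
      · simp
    refine (Finset.sum_le_sum fun j _ => h1 j).trans ?_
    rw [Finset.sum_sub_distrib, Finset.sum_ite_eq' Finset.univ e, if_pos (Finset.mem_univ e)]
    unfold hedgeDist
    apply le_of_eq
    field_simp
  have hlog : Real.log (∑ j, hedgeUpdate η w (feedback e c) j) ≤
      Real.log (∑ j, w j) - δ * (hedgeDist w e * c) := by
    have hpos : 0 < 1 - δ * (hedgeDist w e * c) := by
      by_contra h
      exact (hW'.trans_le hsum).not_ge (mul_nonpos_of_nonneg_of_nonpos hW.le (not_lt.1 h))
    calc _ ≤ _ := Real.log_le_log hW' hsum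
      _ = Real.log (∑ j, w j) + Real.log (1 - δ * (hedgeDist w e * c)) :=
        Real.log_mul hW.ne' hpos.ne'
      _ ≤ _ := by linarith [Real.log_le_sub_one_of_pos hpos]
  have hy : Real.log (hedgeUpdate η w (feedback e c) y) =
      Real.log (w y) - if e = y then η * c else 0 := by
    unfold hedgeUpdate feedback
    rw [Real.log_mul (hw y).ne' (Real.exp_pos _).ne', Real.log_exp]
    by_cases h : e = y
    · simp [h, sub_eq_add_neg]
    · simp [h, Ne.symm h]
  unfold hedgePotential
  rw [hy, div_le_iff₀ hδ]
  have : ((Real.log (∑ j, w j) - Real.log (w y)) / δ - hedgeDist w e * c +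
      if e = y then η / δ * c else 0) * δ = (Real.log (∑ j, w j) - Real.log (w y)) -
      δ * (hedgeDist w e * c) + if e = y then η * c else 0 := by
    split_ifs
    · field_simp
    · field_simp
      ring
  rw [this]
  linarith

lemma rate_le {η δ : ℝ} (hδ : 0 < δ) (hδ' : δ ≤ 1 / 2) (hη : 1 - Real.exp (-η) = δ) :
    η / δ ≤ 1 + 2 * δ := by
  have h1 : Real.exp (-η) = 1 - δ := by linarith
  have h2 : η ≤ Real.exp η - 1 := by linarith [Real.add_one_le_exp η]
  have h3 : Real.exp η = (1 - δ)⁻¹ := by rw [← h1, Real.exp_neg, inv_inv]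
  have h4 : (1 - δ)⁻¹ ≤ 1 + δ + 2 * δ ^ 2 := by
    rw [inv_le_iff_one_le_mul₀ (by linarith)]
    nlinarith [mul_nonneg (sq_nonneg δ) (sub_nonneg.2 hδ')]
  rw [div_le_iff₀ hδ]
  nlinarith

/-- After feedback about a uniformly random arm, the potential of HEDGE drops on average by the
regret of the round, up to a term of second order. -/
lemma sum_hedgePotential_update_le [NeZero ℓ] {η δ : ℝ} (hδ : 0 < δ) (hδ' : δ ≤ 1 / 2)
    (hη : 1 - Real.exp (-η) = δ) (y : Fin ℓ) {c : Fin ℓ → ℝ} (hc : ∀ e, c e ∈ Set.Icc (0 : ℝ) 1)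
    {w : Fin ℓ → ℝ} (hw : ∀ j, 0 < w j) :
    ∑ e, hedgePotential δ y (hedgeUpdate η w (feedback e (c e))) ≤
      ℓ * hedgePotential δ y w - (∑ e, hedgeDist w e * c e - c y) + 2 * δ := by
  refine (Finset.sum_le_sum fun e _ => hedgePotential_update_le hδ hη y e (hc e) hw).trans ?_
  rw [Finset.sum_add_distrib, Finset.sum_sub_distrib, Finset.sum_ite_eq' Finset.univ y,
    if_pos (Finset.mem_univ y)]
  simp only [Finset.sum_const, Finset.card_univ, Fintype.card_fin, nsmul_eq_mul]
  -- The term of e = y is (η / δ) c(y) ≤ c(y) + 2δ, as c(y) ≤ 1.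
  have h := mul_le_mul_of_nonneg_right (rate_le hδ hδ' hη) (hc y).1
  nlinarith [(hc y).1, (hc y).2]

end Hedge

/-! ### Reachable states and the law of the exploited arm -/

section Run

variable {ℓ : ℕ}

/-- The loss of arm `y` in round `t` if `y` has been played since the start. -/
def Adversary.constLoss (A : Adversary ℓ) (t : ℕ) (y : Fin ℓ) : ℝ :=
  A.loss (List.replicate t y)

lemma Adversary.constLoss_mem (A : Adversary ℓ) (t : ℕ) (y : Fin ℓ) :
    A.constLoss t y ∈ Set.Icc (0 : ℝ) 1 :=
  A.loss_mem _

lemma Adversary.MemoryBounded.loss_cons {A : Adversary ℓ} {m : ℕ} (hA : A.MemoryBounded m)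
    {h : History ℓ} {a : Fin ℓ} (hh : ∀ b ∈ h.take m, b = a) :
    A.loss (a :: h) = A.constLoss (h.length + 1) a := by
  refine hA _ _ (by simp) ?_
  rw [List.replicate_succ, List.take_succ_cons, List.take_succ_cons, List.take_replicate,
    List.eq_replicate_of_mem hh, List.length_take]

variable [NeZero ℓ]

lemma finite_support_step (A : Adversary ℓ) (ε : unitInterval) (η : ℝ) (d : ℕ)
    (τ : (Fin ℓ → ℝ) → (Fin ℓ → ℝ) → Fin ℓ → Fin ℓ → ℝ) (s : State ℓ) :
    (step A ε η d τ s).support.Finite := by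
  unfold step
  split
  · refine finite_support_bind (Set.toFinite _) fun β => ?_
    cases β
    · simp
    · exact finite_support_map (Set.toFinite _) _
  · split_ifs
    · simp
    · exact finite_support_map (Set.toFinite _) _

lemma finite_support_init : (init ℓ).support.Finite :=
  finite_support_map (Set.toFinite _) _

lemma finite_support_run (A : Adversary ℓ) (ε : unitInterval) (η : ℝ) (d : ℕ)
    (τ : (Fin ℓ → ℝ) → (Fin ℓ → ℝ) → Fin ℓ → Fin ℓ → ℝ) (t : ℕ) :
    (run A ε η d τ t).support.Finite := by
  induction t with
  | zero => exact finite_support_init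
  | succ t ih => exact finite_support_bind ih (finite_support_step A ε η d τ)

lemma expect_run_succ (A : Adversary ℓ) (ε : unitInterval) (η : ℝ) (d : ℕ)
    (τ : (Fin ℓ → ℝ) → (Fin ℓ → ℝ) → Fin ℓ → Fin ℓ → ℝ) (t : ℕ) (φ : State ℓ → ℝ) :
    expect (run A ε η d τ (t + 1)) φ =
      expect (run A ε η d τ t) fun s => expect (step A ε η d τ s) φ :=
  expect_bind (finite_support_run A ε η d τ t) (finite_support_step A ε η d τ) φ

/-- What holds in every reachable state after `t` rounds: the weights are positive, and during the
bootstrapping of `e` the latest actions are `e`. -/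
structure State.Valid (d t : ℕ) (s : State ℓ) : Prop where
  length_hist : s.hist.length = t
  weights_pos : ∀ j, 0 < s.w j
  block : ∀ e k, s.block = some (e, k) →
    1 ≤ k ∧ k ≤ d ∧ s.hist.take (d - k) = List.replicate (d - k) e

lemma State.Valid.of_mem_support_step {A : Adversary ℓ} {ε : unitInterval} {η : ℝ} {d t : ℕ}
    {τ : (Fin ℓ → ℝ) → (Fin ℓ → ℝ) → Fin ℓ → Fin ℓ → ℝ} (hd : 1 ≤ d) {s s' : State ℓ}
    (hs : s.Valid d t) (h : s' ∈ (step A ε η d τ s).support) : s'.Valid d (t + 1) := by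
  obtain ⟨w, i, b, hist⟩ := s
  obtain ⟨hl, hw, hb⟩ := hs
  dsimp only at hl hw hb
  rcases b with _ | ⟨e, k⟩
  · rw [step, PMF.mem_support_bind_iff] at h
    obtain ⟨β, -, h⟩ := h
    cases β
    · rw [if_neg (by simp), PMF.mem_support_pure_iff] at h
      subst h
      exact ⟨by simp [hl], hw, by simp⟩
    · rw [if_pos rfl, PMF.mem_support_map_iff] at h
      obtain ⟨e, -, rfl⟩ := h
      refine ⟨by simp [hl], hw, ?_⟩
      intro e' k hk
      obtain ⟨rfl, rfl⟩ : e = e' ∧ d = k := by simpa using hk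
      simp [hd]
  · obtain ⟨hk1, hkd, hh⟩ := hb e k rfl
    rw [step] at h
    dsimp only at h
    by_cases hk : 1 < k
    · rw [if_pos hk, PMF.mem_support_pure_iff] at h
      subst h
      refine ⟨by simp [hl], hw, ?_⟩
      intro e' k' hk'
      obtain ⟨rfl, rfl⟩ : e = e' ∧ k - 1 = k' := by simpa using hk'
      refine ⟨by omega, by omega, ?_⟩
      rw [show d - (k - 1) = (d - k) + 1 by omega, List.take_succ_cons, hh, List.replicate_succ]
    · rw [if_neg hk, PMF.mem_support_map_iff] at h
      obtain ⟨i', -, rfl⟩ := h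
      exact ⟨by simp [hl], hedgeUpdate_pos hw _ _, by simp⟩

lemma valid_of_mem_support_run {A : Adversary ℓ} {ε : unitInterval} {η : ℝ} {d : ℕ}
    {τ : (Fin ℓ → ℝ) → (Fin ℓ → ℝ) → Fin ℓ → Fin ℓ → ℝ} (hd : 1 ≤ d) {t : ℕ} {s : State ℓ}
    (h : s ∈ (run A ε η d τ t).support) : s.Valid d t := by
  induction t generalizing s with
  | zero =>
    rw [run, init, PMF.mem_support_map_iff] at h
    obtain ⟨i, -, rfl⟩ := h
    exact ⟨rfl, fun _ => one_pos, by simp⟩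
  | succ t ih =>
    rw [run, PMF.mem_support_bind_iff] at h
    obtain ⟨r, hr, h⟩ := h
    exact (ih hr).of_mem_support_step hd h

/-- The weights after round `t` if arm `e` is explored in that round. -/
noncomputable def Adversary.explore (A : Adversary ℓ) (η : ℝ) (t : ℕ) (e : Fin ℓ)
    (w : Fin ℓ → ℝ) : Fin ℓ → ℝ :=
  hedgeUpdate η w (feedback e (A.constLoss t e))

lemma expect_step_none (A : Adversary ℓ) (ε : unitInterval) (η : ℝ) (d : ℕ)
    (τ : (Fin ℓ → ℝ) → (Fin ℓ → ℝ) → Fin ℓ → Fin ℓ → ℝ) (w : Fin ℓ → ℝ) (i : Fin ℓ)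
    (h : History ℓ) (φ : State ℓ → ℝ) :
    expect (step A ε η d τ ⟨w, i, none, h⟩) φ =
      ε * ((ℓ : ℝ)⁻¹ * ∑ e, φ ⟨w, i, some (e, d), i :: h⟩) +
        (1 - ε) * φ ⟨w, i, none, i :: h⟩ := by
  rw [step, expect_bind (Set.toFinite _), expect_coin, if_pos rfl, if_neg (by simp), expect_pure,
    expect_map (Set.toFinite _), expect_uniformOfFintype, Fintype.card_fin]
  intro β
  cases β
  · simp
  · exact finite_support_map (Set.toFinite _) _

lemma expect_step_of_one_lt (A : Adversary ℓ) (ε : unitInterval) (η : ℝ) (d : ℕ)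
    (τ : (Fin ℓ → ℝ) → (Fin ℓ → ℝ) → Fin ℓ → Fin ℓ → ℝ) (w : Fin ℓ → ℝ) (i e : Fin ℓ) {k : ℕ}
    (hk : 1 < k) (h : History ℓ) (φ : State ℓ → ℝ) :
    expect (step A ε η d τ ⟨w, i, some (e, k), h⟩) φ =
      φ ⟨w, i, some (e, k - 1), e :: h⟩ := by
  rw [step]
  dsimp only
  rw [if_pos hk, expect_pure]

open Classical in
/-- The law of the exploited arm after an update of the distribution from `x` to `x'`. -/
noncomputable def move (τ : (Fin ℓ → ℝ) → (Fin ℓ → ℝ) → Fin ℓ → Fin ℓ → ℝ) (x x' : Fin ℓ → ℝ)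
    (i : Fin ℓ) : PMF (Fin ℓ) :=
  if x' ≠ x then round x (τ x x') i else PMF.pure i

/-- The only place where feedback is used: the m preceding actions are `e`, so the adversary cannot
distinguish the history from the constant one. -/
lemma expect_step_one {A : Adversary ℓ} {m : ℕ} (hA : A.MemoryBounded m) (ε : unitInterval) (η : ℝ)
    (τ : (Fin ℓ → ℝ) → (Fin ℓ → ℝ) → Fin ℓ → Fin ℓ → ℝ) (w : Fin ℓ → ℝ) (i e : Fin ℓ)
    {h : History ℓ} (hh : h.take m = List.replicate m e) (φ : State ℓ → ℝ) :
    expect (step A ε η (m + 1) τ ⟨w, i, some (e, 1), h⟩) φ =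
      expect (move τ (hedgeDist w) (hedgeDist (A.explore η (h.length + 1) e w)) i)
        fun i' => φ ⟨A.explore η (h.length + 1) e w, i', none, e :: h⟩ := by
  have hloss : A.loss (e :: h) = A.constLoss (h.length + 1) e :=
    hA.loss_cons fun b hb => by
      rw [hh] at hb
      exact List.eq_of_mem_replicate hb
  rw [step]
  dsimp only
  rw [if_neg (lt_irrefl 1), expect_map (Set.toFinite _), hloss]
  rfl

/-- `Round` turns a random arm with law `x` into a random arm with law `x'`. -/
lemma sum_expect_move {τ : (Fin ℓ → ℝ) → (Fin ℓ → ℝ) → Fin ℓ → Fin ℓ → ℝ}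
    (hτ : IsTransportRule τ) {w w' : Fin ℓ → ℝ} (hw : ∀ j, 0 < w j) (hw' : ∀ j, 0 < w' j)
    (φ : Fin ℓ → ℝ) :
    ∑ i, hedgeDist w i * expect (move τ (hedgeDist w) (hedgeDist w') i) φ =
      ∑ j, hedgeDist w' j * φ j := by
  unfold move
  split_ifs with h
  · obtain ⟨h0, hrow, hcol, -⟩ := hτ _ (hedgeDist_mem hw) _ (hedgeDist_mem hw')
    have h1 : ∀ i, hedgeDist w i * expect (round (hedgeDist w) (τ (hedgeDist w) (hedgeDist w')) i) φ
        = ∑ j, τ (hedgeDist w) (hedgeDist w') i j * φ j := by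
      intro i
      have hi := hedgeDist_pos hw i
      rw [expect_round hi (h0 i) (hrow i), Finset.mul_sum]
      exact Finset.sum_congr rfl fun j _ => by field_simp
    rw [Finset.sum_congr rfl fun i _ => h1 i, Finset.sum_comm]
    exact Finset.sum_congr rfl fun j _ => by rw [← Finset.sum_mul, hcol]
  · rw [not_not.1 h]
    simp only [expect_pure]

/-- The mean of a function of weights, block and exploited arm over an exploited arm drawn from the
HEDGE distribution. -/
noncomputable def hedgeMean (G : (Fin ℓ → ℝ) → Option (Fin ℓ × ℕ) → Fin ℓ → ℝ) (w : Fin ℓ → ℝ)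
    (b : Option (Fin ℓ × ℕ)) : ℝ :=
  ∑ j, hedgeDist w j * G w b j

/-- The effect of one round after `t` rounds on functions of weights, block and exploited arm. -/
noncomputable def transition (A : Adversary ℓ) (ε : unitInterval) (η : ℝ) (d : ℕ)
    (τ : (Fin ℓ → ℝ) → (Fin ℓ → ℝ) → Fin ℓ → Fin ℓ → ℝ) (t : ℕ)
    (G : (Fin ℓ → ℝ) → Option (Fin ℓ × ℕ) → Fin ℓ → ℝ) (w : Fin ℓ → ℝ) :
    Option (Fin ℓ × ℕ) → Fin ℓ → ℝ
  | none, i => ε * ((ℓ : ℝ)⁻¹ * ∑ e, G w (some (e, d)) i) + (1 - ε) * G w none i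
  | some (e, k), i =>
    if 1 < k then G w (some (e, k - 1)) i
    else expect (move τ (hedgeDist w) (hedgeDist (A.explore η (t + 1) e w)) i)
      fun i' => G (A.explore η (t + 1) e w) none i'

/-- Weights, block and exploited arm form a Markov chain of their own, in which the history no
longer occurs. -/
lemma State.Valid.expect_step_eq_transition {A : Adversary ℓ} {m : ℕ} (hA : A.MemoryBounded m)
    (ε : unitInterval) (η : ℝ) (τ : (Fin ℓ → ℝ) → (Fin ℓ → ℝ) → Fin ℓ → Fin ℓ → ℝ) {t : ℕ}
    {s : State ℓ} (hs : s.Valid (m + 1) t)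
    (G : (Fin ℓ → ℝ) → Option (Fin ℓ × ℕ) → Fin ℓ → ℝ) :
    expect (step A ε η (m + 1) τ s) (fun s => G s.w s.block s.i) =
      transition A ε η (m + 1) τ t G s.w s.block s.i := by
  obtain ⟨w, i, b, h⟩ := s
  rcases b with _ | ⟨e, k⟩
  · rw [expect_step_none]
    rfl
  · obtain ⟨hk1, -, hh⟩ := hs.block e k rfl
    by_cases hk : 1 < k
    · rw [expect_step_of_one_lt A ε η _ τ w i e hk]
      simp [transition, hk]
    · obtain rfl : k = 1 := by omega
      rw [expect_step_one hA ε η τ w i e hh, show h.length = t from hs.length_hist]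
      simp [transition]

lemma hedgeMean_transition (A : Adversary ℓ) (ε : unitInterval) (η : ℝ) (d : ℕ)
    {τ : (Fin ℓ → ℝ) → (Fin ℓ → ℝ) → Fin ℓ → Fin ℓ → ℝ} (hτ : IsTransportRule τ) (t : ℕ)
    (G : (Fin ℓ → ℝ) → Option (Fin ℓ × ℕ) → Fin ℓ → ℝ) {w : Fin ℓ → ℝ} (hw : ∀ j, 0 < w j)
    (b : Option (Fin ℓ × ℕ)) :
    hedgeMean (transition A ε η d τ t fun w b _ => hedgeMean G w b) w b =
      hedgeMean (transition A ε η d τ t G) w b := by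
  rcases b with _ | ⟨e, k⟩
  · simp only [hedgeMean, transition]
    rw [← Finset.sum_mul, sum_hedgeDist hw, one_mul]
    simp only [mul_add, Finset.sum_add_distrib, Finset.mul_sum]
    congr 1
    · rw [Finset.sum_comm]
      exact Finset.sum_congr rfl fun j _ => Finset.sum_congr rfl fun e _ => by ring
    · exact Finset.sum_congr rfl fun j _ => by ring
  · by_cases hk : 1 < k
    · simp only [hedgeMean, transition, hk, if_true]
      rw [← Finset.sum_mul, sum_hedgeDist hw, one_mul]
    · have hw' : ∀ j, 0 < A.explore η (t + 1) e w j := hedgeUpdate_pos hw _ _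
      simp only [hedgeMean, transition, hk, if_false]
      rw [sum_expect_move hτ hw hw', sum_expect_move hτ hw hw', ← Finset.sum_mul,
        sum_hedgeDist hw', one_mul]

/-- Given weights and block, the exploited arm is distributed according to HEDGE. -/
lemma expect_run_eq_hedgeMean {A : Adversary ℓ} {m : ℕ} (hA : A.MemoryBounded m)
    (ε : unitInterval) (η : ℝ) {τ : (Fin ℓ → ℝ) → (Fin ℓ → ℝ) → Fin ℓ → Fin ℓ → ℝ}
    (hτ : IsTransportRule τ) (t : ℕ) (G : (Fin ℓ → ℝ) → Option (Fin ℓ × ℕ) → Fin ℓ → ℝ) :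
    expect (run A ε η (m + 1) τ t) (fun s => G s.w s.block s.i) =
      expect (run A ε η (m + 1) τ t) fun s => hedgeMean G s.w s.block := by
  induction t generalizing G with
  | zero =>
    simp only [run, init]
    rw [expect_map (Set.toFinite _), expect_map (Set.toFinite _)]
    dsimp only
    rw [expect_const (Set.toFinite _), expect_uniformOfFintype]
    simp [hedgeMean, hedgeDist, Finset.mul_sum]
  | succ t ih =>
    -- The induction hypothesis is applied to the transition of `G`, hence the generalization over
    -- `G`. Then `key` is used both for `G` and for its mean.
    have key : ∀ G : (Fin ℓ → ℝ) → Option (Fin ℓ × ℕ) → Fin ℓ → ℝ,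
        expect (run A ε η (m + 1) τ (t + 1)) (fun s => G s.w s.block s.i) =
          expect (run A ε η (m + 1) τ t)
            fun s => hedgeMean (transition A ε η (m + 1) τ t G) s.w s.block := by
      intro G
      rw [expect_run_succ, ← ih]
      exact expect_congr fun s hs =>
        (valid_of_mem_support_run (by omega) hs).expect_step_eq_transition hA ε η τ G
    rw [key, key fun w b _ => hedgeMean G w b]
    exact expect_congr fun s hs => (hedgeMean_transition A ε η (m + 1) hτ t G
      (valid_of_mem_support_run (by omega) hs).weights_pos s.block).symm

end Run

/-! ### The potential and its drift -/

section Potential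

variable {ℓ : ℕ}

/-- The number of further rounds in which `i` must be played until the last `m` actions are `i`. -/
noncomputable def contamination (m : ℕ) (i : Fin ℓ) (h : History ℓ) : ℕ :=
  sInf {n | ∀ a ∈ h.take (m - n), a = i}

lemma contamination_le (m : ℕ) (i : Fin ℓ) (h : History ℓ) : contamination m i h ≤ m :=
  Nat.sInf_le (by simp)

lemma eq_of_mem_take_contamination (m : ℕ) (i : Fin ℓ) (h : History ℓ) :
    ∀ a ∈ h.take (m - contamination m i h), a = i :=
  Nat.sInf_mem (s := {n | ∀ a ∈ h.take (m - n), a = i}) ⟨m, by simp⟩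

lemma contamination_nil (m : ℕ) (i : Fin ℓ) : contamination m i [] = 0 :=
  Nat.le_zero.1 (Nat.sInf_le (by simp))

lemma contamination_cons_le (m : ℕ) (i : Fin ℓ) (h : History ℓ) :
    contamination m i (i :: h) ≤ contamination m i h - 1 := by
  refine Nat.sInf_le fun a ha => ?_
  have ha' : a ∈ (i :: h).take (m - contamination m i h + 1) :=
    (List.take_sublist_take_left (by omega)).subset ha
  rw [List.take_succ_cons, List.mem_cons] at ha'
  exact ha'.elim id (eq_of_mem_take_contamination m i h a)

/-- Either the memory is clean and the loss is the constant one, or the contamination drops by at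
least 1, which covers any loss. -/
lemma Adversary.MemoryBounded.loss_add_contamination_le {A : Adversary ℓ} {m : ℕ}
    (hA : A.MemoryBounded m) (i : Fin ℓ) (h : History ℓ) :
    A.loss (i :: h) + contamination m i (i :: h) ≤
      A.constLoss (h.length + 1) i + contamination m i h := by
  have h1 := contamination_cons_le m i h
  rcases Nat.eq_zero_or_pos (contamination m i h) with h0 | h0
  · have h2 := eq_of_mem_take_contamination m i h
    rw [h0, Nat.sub_zero] at h2
    rw [hA.loss_cons h2, h0, show contamination m i (i :: h) = 0 by omega]
  · have h2 : contamination m i (i :: h) + 1 ≤ contamination m i h := by omega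
    have h3 : (contamination m i (i :: h) : ℝ) + 1 ≤ contamination m i h := by exact_mod_cast h2
    linarith [(A.loss_mem (i :: h)).2, (A.constLoss_mem (h.length + 1) i).1]

/-- The regret of HEDGE with weights `w` in round `t`, if all arms have been played constantly. -/
noncomputable def Adversary.hedgeRegret (A : Adversary ℓ) (y : Fin ℓ) (t : ℕ) (w : Fin ℓ → ℝ) : ℝ :=
  ∑ e, hedgeDist w e * A.constLoss t e - A.constLoss t y

lemma Adversary.abs_hedgeRegret_le [NeZero ℓ] (A : Adversary ℓ) (y : Fin ℓ) (t : ℕ)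
    {w : Fin ℓ → ℝ} (hw : ∀ j, 0 < w j) : |A.hedgeRegret y t w| ≤ 1 := by
  have h0 : 0 ≤ ∑ e, hedgeDist w e * A.constLoss t e :=
    Finset.sum_nonneg fun e _ => mul_nonneg (hedgeDist_pos hw e).le (A.constLoss_mem t e).1
  have h1 : ∑ e, hedgeDist w e * A.constLoss t e ≤ 1 := by
    rw [← sum_hedgeDist hw]
    exact Finset.sum_le_sum fun e _ =>
      mul_le_of_le_one_right (hedgeDist_pos hw e).le (A.constLoss_mem t e).2
  have := A.constLoss_mem t y
  unfold Adversary.hedgeRegret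
  rw [abs_le]
  constructor <;> linarith [this.1, this.2]

/-- The regret of HEDGE with fixed weights `w` in the rounds `t + 1, …, t + d`. -/
noncomputable def Adversary.windowRegret (A : Adversary ℓ) (y : Fin ℓ) (d t : ℕ)
    (w : Fin ℓ → ℝ) : ℝ :=
  ∑ j ∈ Finset.range d, A.hedgeRegret y (t + 1 + j) w

lemma Adversary.abs_windowRegret_le [NeZero ℓ] (A : Adversary ℓ) (y : Fin ℓ) (d t : ℕ)
    {w : Fin ℓ → ℝ} (hw : ∀ j, 0 < w j) : |A.windowRegret y d t w| ≤ d := by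
  refine (Finset.abs_sum_le_sum_abs _ _).trans ?_
  refine (Finset.sum_le_sum fun j _ => A.abs_hedgeRegret_le y (t + 1 + j) hw).trans ?_
  simp

lemma Adversary.windowRegret_succ (A : Adversary ℓ) (y : Fin ℓ) (d t : ℕ) (w : Fin ℓ → ℝ) :
    A.windowRegret y d (t + 1) w =
      A.windowRegret y d t w + A.hedgeRegret y (t + 1 + d) w - A.hedgeRegret y (t + 1) w := by
  have h1 := Finset.sum_range_succ (fun j => A.hedgeRegret y (t + 1 + j) w) d
  have h2 := Finset.sum_range_succ' (fun j => A.hedgeRegret y (t + 1 + j) w) d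
  rw [h1] at h2
  have h3 : A.windowRegret y d (t + 1) w =
      ∑ j ∈ Finset.range d, A.hedgeRegret y (t + 1 + (j + 1)) w :=
    Finset.sum_congr rfl fun j _ => by rw [show t + 1 + 1 + j = t + 1 + (j + 1) by omega]
  rw [h3]
  unfold Adversary.windowRegret
  rw [add_zero] at h2
  linarith

lemma Adversary.totalLoss_replicate_succ (A : Adversary ℓ) (t : ℕ) (y : Fin ℓ) :
    A.totalLoss (List.replicate (t + 1) y) =
      A.constLoss (t + 1) y + A.totalLoss (List.replicate t y) :=
  rfl

/-- A potential for the regret with respect to `y` after `t` rounds.  It pays for the rounds in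
which the memory of the adversary contains other arms than the current one, for the delay between
the decision to explore and the exploration, and, with the factor `B`, for the regret of HEDGE. -/
noncomputable def potential (A : Adversary ℓ) (η δ B : ℝ) (m : ℕ) (y : Fin ℓ) (t : ℕ)
    (s : State ℓ) : ℝ :=
  match s.block with
  | none => contamination m s.i s.hist + A.windowRegret y (m + 1) t s.w +
      B * hedgePotential δ y s.w
  | some (e, k) => m + k + (m + 1) + B * hedgePotential δ y (A.explore η (t + k) e s.w)

/-- The bound on the loss of one round that is not covered by the potential. -/
noncomputable def roundCost (A : Adversary ℓ) (ε : unitInterval) (δ : ℝ) (m : ℕ) (y : Fin ℓ) (t : ℕ)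
    (w : Fin ℓ → ℝ) : Option (Fin ℓ × ℕ) → Fin ℓ → ℝ
  | none, i => A.constLoss (t + 1) i - A.hedgeRegret y (t + 1) w + 2 * δ + ε * (4 * m + 6)
  | some _, _ => 0

variable [NeZero ℓ]

lemma State.Valid.expect_step_potential_le {A : Adversary ℓ} {m : ℕ} (hA : A.MemoryBounded m)
    {ε : unitInterval} {η δ B : ℝ} (hδ : 0 < δ) (hδ' : δ ≤ 1 / 2) (hη : 1 - Real.exp (-η) = δ)
    (hB : ε * B = ℓ) (τ : (Fin ℓ → ℝ) → (Fin ℓ → ℝ) → Fin ℓ → Fin ℓ → ℝ) (y : Fin ℓ) {t : ℕ}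
    {s : State ℓ} (hs : s.Valid (m + 1) t) :
    expect (step A ε η (m + 1) τ s)
        (fun s' => A.totalLoss s'.hist + potential A η δ B m y (t + 1) s') ≤
      A.totalLoss s.hist + potential A η δ B m y t s +
        roundCost A ε δ m y t s.w s.block s.i := by
  obtain ⟨w, i, b, h⟩ := s
  have hw : ∀ j, 0 < w j := hs.weights_pos
  obtain rfl : h.length = t := hs.length_hist
  rcases b with _ | ⟨e, k⟩
  · rw [expect_step_none]
    simp only [potential, roundCost, Adversary.totalLoss]
    have hS := sum_hedgePotential_update_le hδ hδ' hη y
      (A.constLoss_mem (h.length + 1 + (m + 1))) hw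
    change ∑ e, hedgePotential δ y (A.explore η (h.length + 1 + (m + 1)) e w) ≤
      ℓ * hedgePotential δ y w - A.hedgeRegret y (h.length + 1 + (m + 1)) w + 2 * δ at hS
    rw [A.windowRegret_succ y (m + 1) h.length w]
    simp only [Finset.sum_add_distrib, ← Finset.mul_sum, Finset.sum_const, Finset.card_univ,
      Fintype.card_fin, nsmul_eq_mul]
    push_cast
    set S := ∑ e, hedgePotential δ y (A.explore η (h.length + 1 + (m + 1)) e w)
    set Q := hedgePotential δ y w
    have hℓ : (ℓ : ℝ) ≠ 0 := Nat.cast_ne_zero.2 (NeZero.ne ℓ)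
    have hr := hA.loss_add_contamination_le i h
    have hL := (A.loss_mem (i :: h)).2
    have hc := (A.constLoss_mem (h.length + 1) i).1
    have h1 := abs_le.1 (A.abs_hedgeRegret_le y (h.length + 1) hw)
    have h2 := abs_le.1 (A.abs_hedgeRegret_le y (h.length + 1 + (m + 1)) hw)
    have hD := abs_le.1 (A.abs_windowRegret_le y (m + 1) h.length hw)
    push_cast at hD
    have hr0 : (0 : ℝ) ≤ contamination m i h := Nat.cast_nonneg _
    -- By εB = ℓ, the probability ε / ℓ of exploring a given arm cancels against the factor B.
    have hexp : (ε : ℝ) * ((ℓ : ℝ)⁻¹ * (ℓ * A.loss (i :: h) + ℓ * A.totalLoss h +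
        (ℓ * m + ℓ * (m + 1) + (ℓ * m + ℓ * 1) + B * S))) =
        ε * (A.loss (i :: h) + A.totalLoss h + (m + (m + 1) + (m + 1))) + S := by
      have : (ε : ℝ) * ((ℓ : ℝ)⁻¹ * (B * S)) = S := by
        rw [show (ε : ℝ) * ((ℓ : ℝ)⁻¹ * (B * S)) = (ε * B) * (ℓ : ℝ)⁻¹ * S by ring, hB,
          mul_inv_cancel₀ hℓ, one_mul]
      conv_rhs => rw [← this]
      field_simp
      ring
    rw [hexp]
    rw [← hB] at hS
    have hε0 := ε.2.1
    have hε1 : 0 ≤ 1 - (ε : ℝ) := sub_nonneg.2 ε.2.2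
    have k1 := mul_le_mul_of_nonneg_left hr hε1
    -- Price of an exploration: 3m + 2 for the new block, 1 for the loss, m + 1 for the lost window
    -- and 1 for each of the two single-round regrets, in total 4m + 6.
    have k2 : (ε : ℝ) * (A.loss (i :: h) + (m + (m + 1) + (m + 1)) -
        A.constLoss (h.length + 1) i - contamination m i h - A.windowRegret y (m + 1) h.length w -
        A.hedgeRegret y (h.length + 1 + (m + 1)) w + A.hedgeRegret y (h.length + 1) w) ≤
        ε * (4 * m + 6) :=
      mul_le_mul_of_nonneg_left (by linarith) hε0
    linarith
  · obtain ⟨hk1, -, hh⟩ := hs.block e k rfl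
    have hL := (A.loss_mem (e :: h)).2
    by_cases hk : 1 < k
    · rw [expect_step_of_one_lt A ε η _ τ w i e hk]
      simp only [potential, roundCost, Adversary.totalLoss]
      -- The feedback round stays the same, and the decrease of k pays for the loss of this round.
      rw [show h.length + 1 + (k - 1) = h.length + k by omega, Nat.cast_sub hk1]
      push_cast
      linarith
    · obtain rfl : k = 1 := by omega
      rw [expect_step_one hA ε η τ w i e hh]
      -- For every outcome of `Round`, the prepaid m, k = 1 and m + 1 cover the contamination, the
      -- loss and the new window.
      refine (expect_mono (Set.toFinite _) (ψ := fun _ => _) fun i' _ => ?_).trans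
        (expect_const (Set.toFinite _) _).le
      have hw' : ∀ j, 0 < A.explore η (h.length + 1) e w j := hedgeUpdate_pos hw _ _
      have hD := abs_le.1 (A.abs_windowRegret_le y (m + 1) (h.length + 1) hw')
      have hr : (contamination m i' (e :: h) : ℝ) ≤ m := by
        exact_mod_cast contamination_le m i' (e :: h)
      simp only [potential, roundCost, Adversary.totalLoss]
      push_cast at hD ⊢
      linarith

/-- Averaging the exploited arm over the HEDGE distribution cancels the HEDGE loss in
`A.hedgeRegret` and leaves the loss of `y`. Inside a block the cost is 0. -/
lemma expect_roundCost_le {A : Adversary ℓ} {m : ℕ} (hA : A.MemoryBounded m)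
    (ε : unitInterval) (η : ℝ) {δ : ℝ} (hδ : 0 < δ)
    {τ : (Fin ℓ → ℝ) → (Fin ℓ → ℝ) → Fin ℓ → Fin ℓ → ℝ} (hτ : IsTransportRule τ) (y : Fin ℓ)
    (t : ℕ) :
    expect (run A ε η (m + 1) τ t) (fun s => roundCost A ε δ m y t s.w s.block s.i) ≤
      A.constLoss (t + 1) y + (2 * δ + ε * (4 * m + 6)) := by
  have hfin := finite_support_run A ε η (m + 1) τ t
  rw [expect_run_eq_hedgeMean hA ε η hτ t (roundCost A ε δ m y t)]
  refine (expect_mono hfin (ψ := fun _ => _) fun s hs => ?_).trans (expect_const hfin _).le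
  have hw := (valid_of_mem_support_run (by omega) hs).weights_pos
  cases s.block with
  | none =>
    have h1 : hedgeMean (roundCost A ε δ m y t) s.w none =
        ∑ j, hedgeDist s.w j * A.constLoss (t + 1) j +
          (-A.hedgeRegret y (t + 1) s.w + 2 * δ + ε * (4 * m + 6)) := by
      rw [← one_mul (-A.hedgeRegret y (t + 1) s.w + 2 * δ + ε * (4 * m + 6)),
        ← sum_hedgeDist hw, Finset.sum_mul, ← Finset.sum_add_distrib]
      exact Finset.sum_congr rfl fun j _ => by
        simp only [roundCost]
        ring
    rw [h1]
    unfold Adversary.hedgeRegret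
    linarith
  | some b =>
    simp only [hedgeMean, roundCost, mul_zero, Finset.sum_const_zero]
    have := (A.constLoss_mem (t + 1) y).1
    have := ε.2.1
    positivity

lemma expect_run_potential_le {A : Adversary ℓ} {m : ℕ} (hA : A.MemoryBounded m)
    {ε : unitInterval} {η δ B : ℝ} (hδ : 0 < δ) (hδ' : δ ≤ 1 / 2) (hη : 1 - Real.exp (-η) = δ)
    (hB : ε * B = ℓ) {τ : (Fin ℓ → ℝ) → (Fin ℓ → ℝ) → Fin ℓ → Fin ℓ → ℝ} (hτ : IsTransportRule τ)
    (y : Fin ℓ) (t : ℕ) :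
    expect (run A ε η (m + 1) τ t)
        (fun s => A.totalLoss s.hist + potential A η δ B m y t s) ≤
      (m + 1) + B * (Real.log ℓ / δ) + A.totalLoss (List.replicate t y) +
        t * (2 * δ + ε * (4 * m + 6)) := by
  induction t with
  | zero =>
    rw [run, init, expect_map (Set.toFinite _)]
    refine (expect_mono (Set.toFinite _) (ψ := fun _ => _) fun i _ => ?_).trans
      (expect_const (Set.toFinite _) _).le
    have hD := abs_le.1 (A.abs_windowRegret_le y (m + 1) 0 (w := fun _ => 1) fun _ => one_pos)
    push_cast at hD
    simp only [potential, contamination_nil, Adversary.totalLoss, hedgePotential, Finset.sum_const,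
      Finset.card_univ, Fintype.card_fin, nsmul_eq_mul, mul_one, Real.log_one, sub_zero,
      List.replicate_zero, Nat.cast_zero]
    linarith
  | succ t ih =>
    have hfin := finite_support_run A ε η (m + 1) τ t
    rw [expect_run_succ, A.totalLoss_replicate_succ]
    refine (expect_mono hfin fun s hs => (valid_of_mem_support_run (by omega) hs
      ).expect_step_potential_le hA hδ hδ' hη hB τ y).trans ?_
    rw [expect_add hfin]
    have := expect_roundCost_le hA ε η hδ hτ y t
    push_cast
    linarith

lemma expect_totalLoss_le {A : Adversary ℓ} {m : ℕ} (hA : A.MemoryBounded m)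
    {ε : unitInterval} {η δ B : ℝ} (hδ : 0 < δ) (hδ' : δ ≤ 1 / 2) (hη : 1 - Real.exp (-η) = δ)
    (hB0 : 0 ≤ B) (hB : ε * B = ℓ) {τ : (Fin ℓ → ℝ) → (Fin ℓ → ℝ) → Fin ℓ → Fin ℓ → ℝ}
    (hτ : IsTransportRule τ) (y : Fin ℓ) (T : ℕ) :
    expect (play A ε η (m + 1) τ T) A.totalLoss ≤
      A.totalLoss (List.replicate T y) + 2 * (m + 1) + B * (Real.log ℓ / δ) +
        T * (2 * δ + ε * (4 * m + 6)) := by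
  have hfin := finite_support_run A ε η (m + 1) τ T
  have h1 := expect_run_potential_le hA hδ hδ' hη hB hτ y T
  have h2 : -((m : ℝ) + 1) ≤ expect (run A ε η (m + 1) τ T) (potential A η δ B m y T) := by
    refine (expect_const hfin _).ge.trans (expect_mono hfin fun s hs => ?_)
    have hw := (valid_of_mem_support_run (by omega) hs).weights_pos
    rw [potential]
    split
    · have hD := abs_le.1 (A.abs_windowRegret_le y (m + 1) T hw)
      have hQ := mul_nonneg hB0 (hedgePotential_nonneg hδ y hw)
      have hr : (0 : ℝ) ≤ contamination m s.i s.hist := Nat.cast_nonneg _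
      push_cast at hD
      linarith
    · rename_i e k _
      have hQ := mul_nonneg hB0 (hedgePotential_nonneg hδ y
        (w := A.explore η (T + k) e s.w) (hedgeUpdate_pos hw _ _))
      have hm : (0 : ℝ) ≤ m := Nat.cast_nonneg _
      have hk : (0 : ℝ) ≤ k := Nat.cast_nonneg _
      linarith
  rw [expect_add hfin] at h1
  rw [play, expect_map hfin]
  linarith

end Potential

/-! ### From the potential to the policy regret -/

section Regret

variable {ℓ : ℕ}

lemma Adversary.totalLoss_nonneg (A : Adversary ℓ) (h : History ℓ) : 0 ≤ A.totalLoss h := by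
  induction h with
  | nil => exact le_rfl
  | cons a h ih => exact add_nonneg (A.loss_mem _).1 ih

lemma Adversary.totalLoss_le_length (A : Adversary ℓ) (h : History ℓ) :
    A.totalLoss h ≤ h.length := by
  induction h with
  | nil => simp [Adversary.totalLoss]
  | cons a h ih =>
    rw [Adversary.totalLoss, List.length_cons]
    push_cast
    linarith [(A.loss_mem (a :: h)).2]

variable [NeZero ℓ]

lemma policyRegret_le {A : Adversary ℓ} {T : ℕ} {p : PMF (History ℓ)} {c : ℝ}
    (h : ∀ y, expect p A.totalLoss ≤ A.totalLoss (List.replicate T y) + c) :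
    policyRegret A T p ≤ c := by
  rw [policyRegret, sub_le_comm]
  exact Finset.le_inf' _ _ fun y _ => by linarith [h y]

lemma expect_play_le {A : Adversary ℓ} {ε : unitInterval} {η : ℝ} {d : ℕ}
    {τ : (Fin ℓ → ℝ) → (Fin ℓ → ℝ) → Fin ℓ → Fin ℓ → ℝ} (hd : 1 ≤ d) {T : ℕ}
    {φ : History ℓ → ℝ} {c : ℝ} (h : ∀ l : History ℓ, l.length = T → φ l ≤ c) :
    expect (play A ε η d τ T) φ ≤ c := by
  have hfin := finite_support_run A ε η d τ T
  rw [play, expect_map hfin]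
  exact (expect_mono hfin fun s hs => h _ (valid_of_mem_support_run hd hs).length_hist).trans
    (expect_const hfin c).le

lemma policyRegret_play_le (A : Adversary ℓ) (ε : unitInterval) (η : ℝ) {d : ℕ}
    (τ : (Fin ℓ → ℝ) → (Fin ℓ → ℝ) → Fin ℓ → Fin ℓ → ℝ) (hd : 1 ≤ d) (T : ℕ) :
    policyRegret A T (play A ε η d τ T) ≤ T := by
  refine policyRegret_le fun y => ?_
  have h : expect (play A ε η d τ T) A.totalLoss ≤ T :=
    expect_play_le hd fun l hl => hl ▸ A.totalLoss_le_length l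
  linarith [A.totalLoss_nonneg (List.replicate T y)]

lemma policyRegret_play_le_zero (A : Adversary 1) (ε : unitInterval) (η : ℝ) {d : ℕ}
    (τ : (Fin 1 → ℝ) → (Fin 1 → ℝ) → Fin 1 → Fin 1 → ℝ) (hd : 1 ≤ d) (T : ℕ) :
    policyRegret A T (play A ε η d τ T) ≤ 0 := by
  refine policyRegret_le fun y => ?_
  rw [add_zero]
  refine expect_play_le hd fun l hl => ?_
  rw [List.eq_replicate_of_mem (l := l) fun b _ => Subsingleton.elim b y, hl]

/-- The regret bound in terms of the learning rate `δ = 1 - exp (-η)`. -/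
lemma policyRegret_play_le_mul {A : Adversary ℓ} {m T : ℕ} (hm : 1 ≤ m) (hA : A.MemoryBounded m)
    {ε : unitInterval} {η δ : ℝ} (hδ : 0 < δ) (hη : 1 - Real.exp (-η) = δ)
    (hε : m * (ε : ℝ) = δ) (hT : δ ^ 3 * T = m * ℓ * Real.log ℓ) (hmT : m ≤ δ * T)
    {τ : (Fin ℓ → ℝ) → (Fin ℓ → ℝ) → Fin ℓ → Fin ℓ → ℝ} (hτ : IsTransportRule τ) :
    policyRegret A T (play A ε η (m + 1) τ T) ≤ 17 * (δ * T) := by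
  have hT0 : (0 : ℝ) ≤ T := Nat.cast_nonneg T
  have hm1 : (1 : ℝ) ≤ m := by exact_mod_cast hm
  rcases le_total δ (1 / 2) with hδ' | hδ'
  · have hε0 : 0 < (ε : ℝ) := by
      by_contra h
      nlinarith
    refine policyRegret_le fun y => ?_
    have h := expect_totalLoss_le hA hδ hδ' hη (B := ℓ / ε) (by positivity)
      (mul_div_cancel₀ _ hε0.ne') hτ y T
    have h1 : (ℓ : ℝ) / ε * (Real.log ℓ / δ) = δ * T := by
      rw [div_mul_div_comm, div_eq_iff (by positivity)]
      have : (m : ℝ) * (ℓ * Real.log ℓ) = m * (δ * T * (ε * δ)) := by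
        rw [show (m : ℝ) * (δ * T * (ε * δ)) = δ ^ 2 * T * (m * ε) by ring, hε]
        linarith
      exact mul_left_cancel₀ (by positivity) this
    have h2 : (ε : ℝ) * (4 * m + 6) ≤ 10 * δ := by
      rw [← hε]
      nlinarith
    have h3 : (T : ℝ) * (2 * δ + ε * (4 * m + 6)) ≤ T * (12 * δ) :=
      mul_le_mul_of_nonneg_left (by linarith) hT0
    -- 17 = 4 + 1 + 12: here 2(m + 1) ≤ 4m ≤ 4δT, the HEDGE term equals δT, and the rounds cost at
    -- most 12δT.
    rw [h1] at h
    linarith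
  -- For δ ≥ 1/2 the trivial bound T ≤ 2δT suffices.
  · refine (policyRegret_play_le A ε η τ (by omega) T).trans ?_
    nlinarith

end Regret

end MemoryBandit

/-! ### The choice of the parameters -/

theorem mainTheorem5 :
    ∃ C : ℝ, 0 < C ∧
      ∀ (ℓ m T : ℕ) [NeZero ℓ], 1 ≤ m →
      ∀ (ε : unitInterval) (η : ℝ), 0 ≤ η →
      ((m : ℝ) * ℓ * Real.log ℓ < T →
        (ε : ℝ) = ((ℓ : ℝ) * Real.log ℓ) ^ (1 / 3 : ℝ) * (m : ℝ) ^ (-(2 / 3) : ℝ)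
            * (T : ℝ) ^ (-(1 / 3) : ℝ) ∧
        1 - Real.exp (-η) = ((m : ℝ) * ℓ * Real.log ℓ) ^ (1 / 3 : ℝ) * (T : ℝ) ^ (-(1 / 3) : ℝ)) →
      ∀ τ : (Fin ℓ → ℝ) → (Fin ℓ → ℝ) → Fin ℓ → Fin ℓ → ℝ, MemoryBandit.IsTransportRule τ →
      ∀ A : MemoryBandit.Adversary ℓ, A.MemoryBounded m →
        MemoryBandit.policyRegret A T (MemoryBandit.play A ε η (m + 1) τ T)
          ≤ C * ((m : ℝ) * ℓ * Real.log ℓ) ^ (1 / 3 : ℝ) * (T : ℝ) ^ (2 / 3 : ℝ) := by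
  refine ⟨17, by norm_num, ?_⟩
  intro ℓ m T _ hm ε η _ hpar τ hτ A hA
  have hm0 : (0 : ℝ) < m := by exact_mod_cast hm
  have hℓ1 : 1 ≤ ℓ := Nat.one_le_iff_ne_zero.2 (NeZero.ne ℓ)
  rcases hℓ1.eq_or_lt with rfl | hℓ
  · refine (MemoryBandit.policyRegret_play_le_zero A ε η τ (by omega) T).trans ?_
    simp
  have hℓ2 : (2 : ℝ) ≤ ℓ := by exact_mod_cast hℓ
  -- Since 2 log 2 > 1. This gives m ≤ mℓ log ℓ < T below, so the additive term 2(m + 1) is of order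
  -- δT.
  have hlog : 1 ≤ (ℓ : ℝ) * Real.log ℓ := by
    have h1 : Real.log 2 ≤ Real.log ℓ := Real.log_le_log (by norm_num) hℓ2
    nlinarith [Real.log_two_gt_d9]
  have hK : (0 : ℝ) < m * ℓ * Real.log ℓ := by
    rw [mul_assoc]
    positivity
  have hT13 : (T : ℝ) ^ (1 / 3 : ℝ) * (T : ℝ) ^ (2 / 3 : ℝ) = T := by
    rw [← Real.rpow_add' (Nat.cast_nonneg T) (by norm_num)]
    norm_num
  rcases le_or_gt (T : ℝ) (m * ℓ * Real.log ℓ) with hT | hT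
  · refine (MemoryBandit.policyRegret_play_le A ε η τ (by omega) T).trans ?_
    have h1 : (T : ℝ) ^ (1 / 3 : ℝ) ≤ ((m : ℝ) * ℓ * Real.log ℓ) ^ (1 / 3 : ℝ) :=
      Real.rpow_le_rpow (Nat.cast_nonneg T) hT (by norm_num)
    have h2 := mul_le_mul_of_nonneg_right h1 (Real.rpow_nonneg (Nat.cast_nonneg T) (2 / 3 : ℝ))
    rw [hT13] at h2
    linarith [(Nat.cast_nonneg T : (0 : ℝ) ≤ T)]
  · obtain ⟨hε, hη⟩ := hpar hT
    have hT0 : (0 : ℝ) < T := hK.trans hT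
    set δ : ℝ := ((m : ℝ) * ℓ * Real.log ℓ) ^ (1 / 3 : ℝ) * (T : ℝ) ^ (-(1 / 3) : ℝ) with hδ
    have hδT : δ * T = ((m : ℝ) * ℓ * Real.log ℓ) ^ (1 / 3 : ℝ) * (T : ℝ) ^ (2 / 3 : ℝ) := by
      rw [hδ, mul_assoc]
      congr 1
      rw [← Real.rpow_add_one hT0.ne']
      norm_num
    rw [mul_assoc 17, ← hδT]
    refine MemoryBandit.policyRegret_play_le_mul hm hA (by positivity) hη ?_ ?_ ?_ hτ
    · rw [hε, hδ, mul_assoc (m : ℝ), Real.mul_rpow hm0.le (by positivity)]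
      have : (m : ℝ) * (m : ℝ) ^ (-(2 / 3) : ℝ) = (m : ℝ) ^ (1 / 3 : ℝ) := by
        rw [mul_comm, ← Real.rpow_add_one hm0.ne']
        norm_num
      rw [← this]
      ring
    · rw [hδ, mul_pow, ← Real.rpow_natCast, ← Real.rpow_natCast, ← Real.rpow_mul hK.le,
        ← Real.rpow_mul hT0.le]
      norm_num
      rw [mul_assoc, Real.rpow_neg_one, inv_mul_cancel₀ hT0.ne', mul_one]
    · have hmK : (m : ℝ) ≤ m * ℓ * Real.log ℓ := by
        rw [mul_assoc]
        exact le_mul_of_one_le_right hm0.le hlog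
      calc (m : ℝ) = (m : ℝ) ^ (1 / 3 : ℝ) * (m : ℝ) ^ (2 / 3 : ℝ) := by
            rw [← Real.rpow_add hm0]
            norm_num
        _ ≤ ((m : ℝ) * ℓ * Real.log ℓ) ^ (1 / 3 : ℝ) * (T : ℝ) ^ (2 / 3 : ℝ) := by
            have := hmK.trans hT.le
            gcongr
        _ = δ * T := hδT.symm
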